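/- Let $n\ge 2$ and let $\alpha>19$ be a real number. In the max-distance network creation game with agents $1,\dots,n$ and edge price $\alpha$, each agent $v$ chooses a set $s_v$ of other agents; a strategy profile $s=(s_1,\dots,s_n)$ determines the undirected graph $G_s$ on $\{1,\dots,n\}$ in which distinct $u,v$ are adjacent if and only if $u\in s_v$ or $v\in s_u$. The cost of agent $v$ is $$c_s(v)=\alpha\,|s_v|+\max_{u} d_{G_s}(u,v),$$ where $d_{G_s}$ is the graph distance, equal to $+\infty$ between different connected components, and the social cost is $\mathrm{Cost}(s)=\sum_{v} c_s(v)$. A profile $s$ is a (pure) Nash equilibrium if $c_s(v)\le c_{s'}(v)$ for every agent $v$ and every profile $s'$ that differs from $s$ at most in the strategy of $v$. Then Nash equilibria exist, the optimal social cost $\min_s \mathrm{Cost}(s)$ (over all strategy profiles) is positive and finite, and the price of anarchy $$\mathrm{PoA}=\frac{\max\{\mathrm{Cost}(s) : s \text{ a Nash equilibrium}\}}{\min_{s}\mathrm{Cost}(s)}$$ is less than $3$. -/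

import Mathlib

open scoped NNReal ENNReal

namespace NetworkCreation

/-- A (pure) strategy profile: every agent `v` chooses a finite set `s v` of agents other than `v`,
the agents to which `v` builds (and pays for) an edge. -/
abbrev Profile (V : Type*) : Type _ := (v : V) → {t : Finset V // v ∉ t}

variable {V : Type*}

/-- The undirected graph created by a strategy profile. -/
def graph (s : Profile V) : SimpleGraph V where
  Adj u v := u ∈ (s v).1 ∨ v ∈ (s u).1
  symm := ⟨fun _ _ h => h.symm⟩
  loopless := ⟨fun v h => h.elim (s v).2 (s v).2⟩

/-- The cost of agent `v`: `α` times the number of edges it builds, plus its maximum distance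
(in `ℕ∞`, with `⊤` between different components) to the agents of the network. -/
noncomputable def agentCost (α : ℝ≥0) (s : Profile V) (v : V) : ℝ≥0∞ :=
  (α : ℝ≥0∞) * ((s v).1.card : ℝ≥0∞) + ((⨆ u, (graph s).edist v u : ℕ∞) : ℝ≥0∞)

/-- The social cost: the sum of the costs of all agents. -/
noncomputable def socialCost [Fintype V] (α : ℝ≥0) (s : Profile V) : ℝ≥0∞ :=
  ∑ v, agentCost α s v

/-- `s` is a pure Nash equilibrium: no agent can lower its cost by changing only its own
strategy. -/
def IsNash (α : ℝ≥0) (s : Profile V) : Prop :=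
  ∀ v : V, ∀ s' : Profile V, (∀ u, u ≠ v → s' u = s u) → agentCost α s v ≤ agentCost α s' v

/-- The social cost of a worst Nash equilibrium. There are finitely many profiles, so that
the supremum is a maximum as soon as an equilibrium exists. -/
noncomputable def worstNashCost (V : Type*) [Fintype V] (α : ℝ≥0) : ℝ≥0∞ :=
  ⨆ s ∈ {s : Profile V | IsNash α s}, socialCost α s

/-- The optimal social cost over all strategy profiles (a minimum, since there are finitely many
of them, and at least one). -/
noncomputable def optimalCost (V : Type*) [Fintype V] (α : ℝ≥0) : ℝ≥0∞ :=
  ⨅ s : Profile V, socialCost α s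

/-- The price of anarchy. -/
noncomputable def priceOfAnarchy (V : Type*) [Fintype V] (α : ℝ≥0) : ℝ≥0∞ :=
  worstNashCost V α / optimalCost V α

end NetworkCreation

set_option linter.unusedSectionVars false

/-! ### Eccentricity and the deviation inequality -/

namespace NetworkCreation

/-! The heart is that equilibrium graphs are trees when α > 19. Fix a breadth-first tree rooted at a
vertex `r` of minimal eccentricity. An owner `x` of a non-tree edge could drop it and route through
`r`, so `x` has depth at least α. No agent owns two edges that one new edge to `r` replaces at
eccentricity at most 19 above that of `r` (`eq_of_shallow`). Hence the first ten tree edges above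
`x` are owned by their upper ends, and these paths are disjoint for different non-tree edges.

The core consists of the non-root vertices on tree paths from ends of non-tree edges to `r`. On a
stretch above `x` that does not branch in the core, swapping an edge for one reaching two steps
further forces eccentricities to drop strictly going up (`ecc_lt_of_path`). They can exceed that of
`r` by at most 2, so four consecutive vertices contain a branching one (`exists_branch`). Thus m
non-tree edges yield 2m branching core vertices, while double counting lower neighbours allows fewer
than 2m (`not_nonTree`).

A tree has at most n - 1 paid edges. Buying an edge to `r` bounds every eccentricity by R + 1 + α,
where R is the radius; some vertex has eccentricity at least 2R - 1, so R ≤ α + 2. Summing, an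
equilibrium costs at most 3L - 1 with L = α(n - 1) + n, and L bounds every social cost from below.
The star bought by its leaves is an equilibrium. -/

/-- The eccentricity of a vertex, meaningful in connected graphs. -/
noncomputable def ecc {V : Type*} [Fintype V] (G : SimpleGraph V) (v : V) : ℕ := Finset.univ.sup (G.dist v)

theorem dist_le_ecc {V : Type*} [Fintype V] (G : SimpleGraph V) (v z : V) : G.dist v z ≤ ecc G v :=
  Finset.le_sup (f := G.dist v) (Finset.mem_univ z)

theorem ecc_le {V : Type*} [Fintype V] {G : SimpleGraph V} {v : V} {k : ℕ} (h : ∀ z, G.dist v z ≤ k) : ecc G v ≤ k :=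
  Finset.sup_le fun z _ => h z

theorem edist_le_succ_of_adj {V : Type*} {G : SimpleGraph V} {v p z : V} {k : ℕ}
    (h : G.Adj p z) (hp : G.edist v p ≤ k) : G.edist v z ≤ (k + 1 : ℕ) := by
  refine (SimpleGraph.edist_triangle (v := p)).trans ?_
  rw [SimpleGraph.edist_eq_one_iff_adj.2 h]
  push_cast
  gcongr

theorem edist_le_add {V : Type*} {G : SimpleGraph V} {u v w : V} {k l : ℕ}
    (h : G.edist u v ≤ k) (h' : G.edist v w ≤ l) : G.edist u w ≤ (k + l : ℕ) := by
  refine (SimpleGraph.edist_triangle (v := v)).trans ?_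
  push_cast
  gcongr

theorem edist_le_mono {V : Type*} {G : SimpleGraph V} {u v : V} {k l : ℕ}
    (h : G.edist u v ≤ k) (hkl : k ≤ l) : G.edist u v ≤ l :=
  h.trans (by exact_mod_cast hkl)

theorem agentCost_of_connected {V : Type*} [Fintype V] {s : Profile V} (hG : (graph s).Connected) (α : ℝ≥0) (v : V) :
    agentCost α s v = ((α * (s v).1.card + ecc (graph s) v : ℝ≥0) : ℝ≥0∞) := by
  have : (⨆ u, (graph s).edist v u : ℕ∞) = (ecc (graph s) v : ℕ) := by
    refine le_antisymm (iSup_le fun u => ?_) ?_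
    · rw [← (hG v u).coe_dist_eq_edist]
      exact_mod_cast dist_le_ecc _ v u
    · obtain ⟨z, -, hz⟩ := Finset.exists_mem_eq_sup Finset.univ ⟨v, Finset.mem_univ v⟩
        ((graph s).dist v)
      rw [ecc, hz, (hG v z).coe_dist_eq_edist]
      exact le_iSup (fun u => (graph s).edist v u) z
  rw [agentCost, this]
  push_cast
  rfl

theorem agentCost_le {V : Type*} {s : Profile V} (α : ℝ≥0) {v : V} {b : ℕ}
    (h : ∀ z, (graph s).edist v z ≤ b) :
    agentCost α s v ≤ ((α * (s v).1.card + b : ℝ≥0) : ℝ≥0∞) := by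
  rw [agentCost]
  push_cast
  gcongr
  have : (⨆ u, (graph s).edist v u) ≤ (b : ℕ∞) := iSup_le h
  calc (((⨆ u, (graph s).edist v u : ℕ∞)) : ℝ≥0∞) ≤ ((b : ℕ∞) : ℝ≥0∞) :=
        ENat.toENNReal_le.2 this
    _ = b := ENat.toENNReal_coe b

/-- In an equilibrium the graph is connected. -/
theorem IsNash.connected {V : Type*} [Fintype V] [DecidableEq V] [Nonempty V] {α : ℝ≥0} {s : Profile V} (hs : IsNash α s) :
    (graph s).Connected := by
  refine ⟨fun v u => ?_⟩
  let s' : Profile V := Function.update s v ⟨Finset.univ.erase v, by simp⟩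
  have h := hs v s' fun u hu => Function.update_of_ne hu _ _
  have h' : agentCost α s' v ≤ _ := agentCost_le (b := 1) α fun z => by
    by_cases hz : z = v
    · subst hz; simp
    · have : (graph s').Adj v z := Or.inr (by simp [s', hz])
      exact le_of_eq (SimpleGraph.edist_eq_one_iff_adj.2 this)
  have h2 : agentCost α s v < ⊤ := (h.trans h').trans_lt ENNReal.coe_lt_top
  rw [← SimpleGraph.edist_ne_top_iff_reachable]
  intro htop
  refine h2.ne ?_
  have : (⨆ u, (graph s).edist v u) = ⊤ := top_le_iff.1 (htop ▸ le_iSup (fun u => (graph s).edist v u) u)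
  rw [agentCost, this]
  simp

/-- The basic inequality of an equilibrium: agent `v` drops its edges to `X` and buys edges
to `A`. -/
theorem IsNash.deviation {V : Type*} [Fintype V] [DecidableEq V] {α : ℝ≥0} {s : Profile V} (hs : IsNash α s)
    (hG : (graph s).Connected) {v : V} {X : Finset V} (hX : X ⊆ (s v).1) (A : Finset V) (b : ℕ)
    -- The new graph is only bounded from below: an edge into `X` survives if its other end also
    -- pays for it.
    (H : ∀ G' : SimpleGraph V,
      (∀ p q, (graph s).Adj p q → (p = v → q ∉ X) → (q = v → p ∉ X) → G'.Adj p q) →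
      (∀ a ∈ A, a ≠ v → G'.Adj v a) → ∀ z, G'.edist v z ≤ b) :
    (α : ℝ) * X.card + ecc (graph s) v ≤ α * A.card + b := by
  set S : Finset V := ((s v).1 \ X) ∪ A.erase v with hS
  have hvS : v ∉ S := by simp [S, (s v).2]
  let s' : Profile V := Function.update s v ⟨S, hvS⟩
  have hsv : (s' v).1 = S := by simp [s']
  have hsu : ∀ u, u ≠ v → s' u = s u := fun u hu => Function.update_of_ne hu _ _
  have h := hs v s' hsu
  have key : ∀ q, v ≠ q → (graph s).Adj v q → q ∉ X → (graph s').Adj v q := by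
    intro q hq h hqX
    rcases h with h | h
    · exact Or.inl (by rw [hsu q hq.symm]; exact h)
    · exact Or.inr (by rw [hsv]; simp [S, h, hqX])
  have h' : agentCost α s' v ≤ _ := agentCost_le (b := b) α (H (graph s') ?_ ?_)
  · rw [agentCost_of_connected hG] at h
    have h3 := ENNReal.coe_le_coe.1 (h.trans h')
    rw [hsv] at h3
    have h4 : (α : ℝ) * (s v).1.card + ecc (graph s) v ≤ α * S.card + b := by exact_mod_cast h3
    have h5 : S.card + X.card ≤ (s v).1.card + A.card := by
      have h6 := Finset.card_union_le ((s v).1 \ X) (A.erase v)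
      have h7 := Finset.card_sdiff_add_card_eq_card hX
      have h8 := Finset.card_erase_le (s := A) (a := v)
      rw [← hS] at h6
      omega
    have h6 : (S.card : ℝ) + X.card ≤ (s v).1.card + A.card := by exact_mod_cast h5
    nlinarith [mul_le_mul_of_nonneg_left h6 α.2]
  · intro p q hpq hp hq
    by_cases hpv : p = v
    · subst hpv
      exact key q hpq.ne hpq (hp rfl)
    · by_cases hqv : q = v
      · subst hqv
        exact (key p (Ne.symm hpv) hpq.symm (hq rfl)).symm
      · rcases hpq with h | h
        · exact Or.inl (by rw [hsu q hqv]; exact h)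
        · exact Or.inr (by rw [hsu p hpv]; exact h)
  · intro a ha hav
    exact Or.inr (by rw [hsv]; simp [S, ha, hav])

/-! ### Breadth-first search trees -/

/-- A breadth-first search tree with root `r`, given by its parent function. -/
structure BFSTree {V : Type*} (G : SimpleGraph V) (r : V) where
  par : V → V
  par_root : par r = r
  adj : ∀ v, v ≠ r → G.Adj (par v) v
  dist_eq : ∀ v, v ≠ r → G.dist r v = G.dist r (par v) + 1

theorem exists_bfsTree {V : Type*} {G : SimpleGraph V} (hG : G.Connected) (r : V) :
    Nonempty (BFSTree G r) := by
  have h : ∀ v, v ≠ r → ∃ p, G.Adj p v ∧ G.dist r v = G.dist r p + 1 := by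
    intro v hv
    obtain ⟨w, hw⟩ := hG.exists_walk_length_eq_dist v r
    cases w with
    | nil => exact absurd rfl hv
    | @cons _ p _ hvp w' =>
      refine ⟨p, hvp.symm, ?_⟩
      have h1 := SimpleGraph.dist_le w'
      have h2 := hG.dist_triangle (u := v) (v := p) (w := r)
      have h3 := SimpleGraph.dist_eq_one_iff_adj.2 hvp
      simp only [SimpleGraph.Walk.length_cons] at hw
      rw [SimpleGraph.dist_comm (u := r), SimpleGraph.dist_comm (u := r)]
      omega
  classical
  choose! f hf using h
  exact ⟨⟨fun v => if v = r then r else f v, by simp, fun v hv => by simp [hv, (hf v hv).1],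
    fun v hv => by simp only [if_neg hv]; exact (hf v hv).2⟩⟩

namespace BFSTree

variable {V : Type*} {G : SimpleGraph V} {r : V}

theorem dist_par (B : BFSTree G r) (v : V) : G.dist r (B.par v) = G.dist r v - 1 := by
  by_cases hv : v = r
  · subst hv; simp [B.par_root]
  · have := B.dist_eq v hv; omega

theorem dist_iterate (B : BFSTree G r) (k : ℕ) (v : V) : G.dist r (B.par^[k] v) = G.dist r v - k := by
  induction k with
  | zero => simp
  | succ k ih => rw [Function.iterate_succ_apply', B.dist_par, ih]; omega

theorem iterate_root (B : BFSTree G r) (k : ℕ) : B.par^[k] r = r := Function.iterate_fixed B.par_root k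

theorem eq_root_of_dist_eq_zero (B : BFSTree G r) {v : V} (h : G.dist r v = 0) : v = r := by
  by_contra hv
  have := B.dist_eq v hv
  omega

theorem dist_pos (B : BFSTree G r) {v : V} (h : v ≠ r) : 0 < G.dist r v :=
  Nat.pos_of_ne_zero fun h0 => h (B.eq_root_of_dist_eq_zero h0)

/-- Induction along the tree, from the root to the leaves. -/
theorem induction (B : BFSTree G r) {P : V → Prop} (root : P r) (step : ∀ v, v ≠ r → P (B.par v) → P v) (v : V) :
    P v := by
  induction hn : G.dist r v generalizing v with
  | zero => rw [B.eq_root_of_dist_eq_zero hn]; exact root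
  | succ n ih =>
    have hv : v ≠ r := by rintro rfl; simp at hn
    exact step v hv (ih _ (by have := B.dist_eq v hv; omega))

/-- The exponent of a descent can be read off the levels. -/
theorem iterate_level (B : BFSTree G r) {a z : V} {k : ℕ} (h : B.par^[k] z = a) :
    B.par^[G.dist r z - G.dist r a] z = a := by
  have h1 := B.dist_iterate k z
  rw [h] at h1
  by_cases hk : k ≤ G.dist r z
  · rwa [show G.dist r z - G.dist r a = k by omega]
  · have : a = r := B.eq_root_of_dist_eq_zero (by omega)
    subst this
    exact B.eq_root_of_dist_eq_zero (by rw [B.dist_iterate]; simp)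

/-- `x` and `y` are joined by an edge outside the tree. -/
def NonTree (B : BFSTree G r) (x y : V) : Prop := G.Adj x y ∧ B.par x ≠ y ∧ B.par y ≠ x

theorem NonTree.symm {B : BFSTree G r} {x y : V} (h : B.NonTree x y) : B.NonTree y x :=
  ⟨h.1.symm, h.2.2, h.2.1⟩

end BFSTree

end NetworkCreation

/-! ### Non-tree edges and the paths above their owners -/

namespace NetworkCreation

variable {V : Type*}

theorem BFSTree.edist_iterate_le {G G' : SimpleGraph V} {r : V} (B : BFSTree G r)
    (h : ∀ z, z ≠ r → G'.Adj (B.par z) z) (k : ℕ) (z : V) : G'.edist z (B.par^[k] z) ≤ k := by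
  induction k with
  | zero => simp
  | succ k ih =>
    rw [Function.iterate_succ_apply']
    by_cases hr : B.par^[k] z = r
    · rw [hr, B.par_root]
      exact edist_le_mono (hr ▸ ih) (Nat.le_succ k)
    · exact edist_le_succ_of_adj (h _ hr).symm ih

theorem BFSTree.edist_root_le {G G' : SimpleGraph V} {r : V} (B : BFSTree G r)
    (h : ∀ z, z ≠ r → G'.Adj (B.par z) z) (z : V) : G'.edist r z ≤ G.dist r z := by
  induction z using B.induction with
  | root => simp
  | step v hv ih =>
    rw [B.dist_eq v hv]
    exact edist_le_succ_of_adj (h v hv) ih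

variable [Fintype V] [DecidableEq V] {α : ℝ≥0} {s : Profile V} {r : V}

/-- An agent `u` that owns an edge to `w` which is not needed to reach anybody from `q` could
swap it for an edge to `q`. -/
theorem IsNash.ecc_le_of_par_ne (hs : IsNash α s) (hG : (graph s).Connected) {q u w : V}
    (B : BFSTree (graph s) q) (hw : w ∈ (s u).1) (hpar : B.par w ≠ u) :
    ecc (graph s) u ≤ ecc (graph s) q + 1 := by
  have h := hs.deviation hG (X := {w}) (by simpa using hw) {q} (ecc (graph s) q + 1) ?_
  · have : (ecc (graph s) u : ℝ) ≤ (ecc (graph s) q + 1 : ℕ) := by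
      simpa using h
    exact_mod_cast this
  · intro G' hk ha z
    refine edist_le_mono (k := (graph s).dist q z + 1) ?_
      (Nat.succ_le_succ (dist_le_ecc _ _ _))
    induction z using B.induction with
    | root =>
      by_cases hq : q = u
      · subst hq; simp
      · exact edist_le_mono (SimpleGraph.edist_eq_one_iff_adj.2 (ha q (by simp) hq)).le (by omega)
    | step v hv ih =>
      -- The tree edge above `u` may be lost, but `u` is the starting point.
      by_cases hvu : v = u
      · subst hvu; simp
      · rw [B.dist_eq v hv]
        refine edist_le_succ_of_adj (hk _ _ (B.adj v hv) ?_ fun h => absurd h hvu) ih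
        rintro h1 h2
        rw [Finset.mem_singleton] at h2
        exact hpar (h2 ▸ h1)

/-- A breadth-first search tree of an equilibrium graph whose root has minimal eccentricity. -/
structure CentralTree (α : ℝ≥0) (s : Profile V) (r : V) extends BFSTree (graph s) r where
  nash : IsNash α s
  connected : (graph s).Connected
  center : ∀ v, ecc (graph s) r ≤ ecc (graph s) v

namespace CentralTree

variable (T : CentralTree α s r)

/-- Dropping a non-tree edge leaves the whole search tree available for detours. -/
theorem adj_of_nonTree {x y : V} (h : T.NonTree x y) {G' : SimpleGraph V}
    (hk : ∀ p q, (graph s).Adj p q → (p = x → q ∉ ({y} : Finset V)) →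
      (q = x → p ∉ ({y} : Finset V)) → G'.Adj p q) (z : V) (hz : z ≠ r) :
    G'.Adj (T.par z) z := by
  refine hk _ _ (T.adj z hz) ?_ ?_
  · rintro h1 h2
    rw [Finset.mem_singleton] at h2
    exact h.2.2 (h2 ▸ h1)
  · rintro h1 h2
    rw [Finset.mem_singleton] at h2
    exact h.2.1 (h1 ▸ h2)

/-- The owner of a non-tree edge is far from the root. -/
theorem le_dist_of_nonTree {x y : V} (h : T.NonTree x y) (hy : y ∈ (s x).1) :
    (α : ℝ) ≤ (graph s).dist r x := by
  -- Without its edge, `x` still reaches everything through the root, whose eccentricity is at most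
  -- its own.
  have hd := T.nash.deviation T.connected (X := {y}) (by simpa using hy) ∅
    ((graph s).dist r x + ecc (graph s) r) ?_
  · have hc : (ecc (graph s) r : ℝ) ≤ ecc (graph s) x := by exact_mod_cast T.center x
    push_cast at hd
    simp only [Finset.card_singleton, Finset.card_empty] at hd
    push_cast at hd
    linarith
  · intro G' hk _ z
    have hr := T.edist_root_le (T.adj_of_nonTree h hk)
    refine edist_le_add (v := r) ?_ (edist_le_mono (hr z) (dist_le_ecc _ _ _))
    rw [SimpleGraph.edist_comm]
    exact hr x

theorem ecc_le_of_nonTree {x y : V} (h : T.NonTree x y) (hy : y ∈ (s x).1) :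
    ecc (graph s) x ≤ ecc (graph s) r + 1 :=
  T.nash.ecc_le_of_par_ne T.connected T.toBFSTree hy h.2.2

/-- The cycle closed by a non-tree edge does not close up near the owner of the edge. -/
theorem iterate_ne_of_nonTree {x y : V} (h : T.NonTree x y) (hy : y ∈ (s x).1) {i : ℕ}
    (hi : 2 * (i : ℝ) < α) (k : ℕ) : T.par^[k] y ≠ T.par^[i] x := by
  intro hk0
  -- The number of steps from `y` may be taken to be the difference of levels, hence at most `i +
  -- 1`.
  have hk' := T.iterate_level hk0
  set k' := (graph s).dist r y - (graph s).dist r (T.par^[i] x) with hkdef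
  have hxy : (graph s).dist r y ≤ (graph s).dist r x + 1 := by
    have h1 := T.connected.dist_triangle (u := r) (v := x) (w := y)
    rwa [SimpleGraph.dist_eq_one_iff_adj.2 h.1] at h1
  have hki : k' ≤ i + 1 := by
    rw [T.dist_iterate] at hkdef
    omega
  have hd := T.nash.deviation T.connected (X := {y}) (by simpa using hy) ∅
    (ecc (graph s) x + 2 * i) ?_
  · push_cast at hd
    simp only [Finset.card_singleton, Finset.card_empty] at hd
    push_cast at hd
    linarith
  · intro G' hk _ z
    have htree := T.adj_of_nonTree h hk
    have h1 := T.edist_iterate_le htree i x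
    have h2 := T.edist_iterate_le htree k' y
    rw [SimpleGraph.edist_comm, hk'] at h2
    have h3 : G'.edist x y ≤ (2 * i + 1 : ℕ) := edist_le_mono (edist_le_add h1 h2) (by omega)
    refine edist_le_mono (k := (graph s).dist x z + 2 * i) ?_
      (Nat.add_le_add_right (dist_le_ecc _ _ _) _)
    -- On shortest paths from `x` only the step to `y` is lost; the tree detour of length at most `2
    -- * i + 1` lengthens each path by at most `2 * i`.
    obtain ⟨Bx⟩ := exists_bfsTree T.connected x
    induction z using Bx.induction with
    | root => simp
    | step v hv ih =>
      by_cases hvy : v = y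
      · subst hvy
        rw [SimpleGraph.dist_eq_one_iff_adj.2 h.1]
        exact edist_le_mono h3 (by omega)
      · rw [Bx.dist_eq v hv]
        refine edist_le_mono (edist_le_succ_of_adj (hk _ _ (Bx.adj v hv) ?_ ?_) ih) (by omega)
        · intro _; simpa using hvy
        · exact fun h => absurd h hv

/-- The edge from `a` to `b` is an edge owned by `a = x` outside the tree, or the tree edge
towards such an `x`, of which `a` is the ancestor of degree at most nine. -/
def Shallow (a b : V) : Prop :=
  ∃ x y, T.NonTree x y ∧ y ∈ (s x).1 ∧ ∃ i ≤ 9, T.par^[i] x = a ∧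
    ((i = 0 ∧ b = y) ∨ ∃ j, i = j + 1 ∧ T.par^[j] x = b)

/-- No agent owns two edges that both can be replaced by a single edge to the root. -/
theorem eq_of_shallow (hα : 19 < α) {a b₁ b₂ : V} (h₁ : b₁ ∈ (s a).1) (h₂ : b₂ ∈ (s a).1)
    (hb₁ : T.par b₁ ≠ a ∨ T.Shallow a b₁) (hb₂ : T.par b₂ ≠ a ∨ T.Shallow a b₂) : b₁ = b₂ := by
  by_contra hne
  have hα' : (19 : ℝ) < α := by exact_mod_cast hα
  -- One edge to `r` replaces both. The 19 is 2·8 + 3: entering the branch at `b` from below,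
  -- through `y` and `x`, costs `2 * j + 3` beyond the level of `b`, with `j ≤ 8`.
  have hd := T.nash.deviation T.connected (v := a) (X := {b₁, b₂})
    (by intro z; simp only [Finset.mem_insert, Finset.mem_singleton]; rintro (rfl | rfl) <;>
          assumption) {r} (ecc (graph s) r + 19) ?_
  · have hc : (ecc (graph s) r : ℝ) ≤ ecc (graph s) a := by exact_mod_cast T.center a
    rw [Finset.card_pair hne, Finset.card_singleton] at hd
    push_cast at hd
    linarith
  · intro G' hk ha z
    have hk' : ∀ p q, (graph s).Adj p q → p ≠ a → q ≠ a → G'.Adj p q := fun p q h hp hq =>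
      hk p q h (fun h => absurd h hp) fun h => absurd h hq
    have hroot : G'.edist a r ≤ (1 : ℕ) := by
      by_cases hr : r = a
      · subst hr; simp
      · exact (SimpleGraph.edist_eq_one_iff_adj.2 (ha r (by simp) hr)).le
    have hnd : ∀ z, (∀ k, T.par^[k] z ≠ a) → G'.edist a z ≤ ((graph s).dist r z + 1 : ℕ) := by
      intro z
      induction z using T.toBFSTree.induction with
      | root => intro _; simpa using hroot
      | step v hv ih =>
        intro hva
        rw [T.dist_eq v hv]
        exact edist_le_succ_of_adj (hk' _ _ (T.adj v hv) (hva 1) (hva 0)) (ih fun k => hva (k + 1))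
    have hsh : ∀ b, T.par b = a → T.Shallow a b → G'.edist a b ≤ ((graph s).dist r b + 19 : ℕ) := by
      rintro b hb ⟨x, y, hxy, hy, i, hi, hia, ⟨rfl, rfl⟩ | ⟨j, rfl, hj⟩⟩
      · exact absurd (hb.trans hia.symm) hxy.2.2
      -- As 2·9 < α, `y` is not below `a`, so the tree path from the root to `y` avoids `a`.
      · have hay := T.iterate_ne_of_nonTree hxy hy (i := j + 1) (by
          have : ((j + 1 : ℕ) : ℝ) ≤ 9 := by exact_mod_cast hi
          linarith)
        rw [hia] at hay
        have hba : b ≠ r := by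
          rintro rfl
          rw [T.par_root] at hb
          subst hb
          refine hay ((graph s).dist b y) ?_
          exact T.toBFSTree.eq_root_of_dist_eq_zero (by rw [T.dist_iterate]; simp)
        have hlev := T.dist_eq b hba
        rw [hb] at hlev
        have hxlev : ∀ l ≤ j, (graph s).dist r (T.par^[l] x) = (graph s).dist r b + (j - l) := by
          intro l hl
          have e1 := T.dist_iterate j x
          have e2 := T.dist_iterate l x
          rw [hj] at e1
          omega
        have hxa : ∀ l ≤ j, T.par^[l] x ≠ a := by
          intro l hl h
          have := hxlev l hl
          rw [h] at this
          omega
        -- One step to the root, at most `dist r x + 1` down to `y`, one across to `x`, then `l` up.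
        have hl : ∀ l ≤ j, G'.edist a (T.par^[l] x) ≤ ((graph s).dist r x + 3 + l : ℕ) := by
          intro l
          induction l with
          | zero =>
            intro _
            have h1 := edist_le_succ_of_adj (hk' y x hxy.1.symm (hay 0) (hxa 0 (Nat.zero_le j)))
              (hnd y hay)
            have h2 := T.connected.dist_triangle (u := r) (v := x) (w := y)
            rw [SimpleGraph.dist_eq_one_iff_adj.2 hxy.1] at h2
            exact edist_le_mono h1 (by omega)
          | succ l ih =>
            intro hl
            have h1 := hxlev l (by omega)
            have h2 : T.par^[l] x ≠ r := by
              intro h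
              rw [h] at h1
              simp at h1
              omega
            have h3 := hxa (l + 1) hl
            rw [Function.iterate_succ_apply'] at h3 ⊢
            exact edist_le_succ_of_adj (hk' _ _ (T.adj _ h2).symm (hxa l (by omega)) h3)
              (ih (by omega))
        have h1 := hl j le_rfl
        have h2 := hxlev 0 (Nat.zero_le j)
        rw [hj] at h1
        simp only [Function.iterate_zero, id] at h2
        exact edist_le_mono h1 (by omega)
    refine edist_le_mono (k := (graph s).dist r z + 19) ?_
      (Nat.add_le_add_right (dist_le_ecc _ _ _) _)
    induction z using T.toBFSTree.induction with
    | root => exact edist_le_mono hroot (by omega)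
    | step v hv ih =>
      by_cases hva : v = a
      · subst hva; simp
      by_cases hpa : T.par v = a
      · by_cases hvb : v = b₁ ∨ v = b₂
        · rcases hvb with rfl | rfl
          · exact hsh _ hpa (hb₁.resolve_left (not_not.2 hpa))
          · exact hsh _ hpa (hb₂.resolve_left (not_not.2 hpa))
        · refine edist_le_mono (k := 1) (SimpleGraph.edist_eq_one_iff_adj.2 ?_).le (by omega)
          exact hk a v (hpa ▸ T.adj v hv) (fun _ => by simpa using hvb) fun h => absurd h hva
      · rw [T.dist_eq v hv]
        exact edist_le_mono (edist_le_succ_of_adj (hk' _ _ (T.adj v hv) hpa hva) ih) (by omega)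

/-- Above the owner of a non-tree edge, the tree edges are owned by their upper ends. -/
theorem mem_iterate (hα : 19 < α) {x y : V} (h : T.NonTree x y) (hy : y ∈ (s x).1) {i : ℕ}
    (hi : i ≤ 9) : T.par^[i] x ≠ r ∧ T.par^[i] x ∈ (s (T.par^[i + 1] x)).1 := by
  have hα' : (19 : ℝ) < α := by exact_mod_cast hα
  -- The level is an integer at least α > 19, so the root is more than nine steps away.
  have hlev : 20 ≤ (graph s).dist r x := by
    have h1 := T.le_dist_of_nonTree h hy
    have : ((19 : ℕ) : ℝ) < (graph s).dist r x := by push_cast; linarith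
    exact_mod_cast this
  have hr : ∀ i ≤ 9, T.par^[i] x ≠ r := by
    intro i hi hir
    have h1 := T.dist_iterate i x
    rw [hir] at h1
    simp at h1
    omega
  refine ⟨hr i hi, ?_⟩
  -- If the lower end paid for its parent edge, it would own two replaceable edges: that one, and
  -- the edge towards `x` (or to `y`) owned by the previous step.
  induction i with
  | zero =>
    have hadj := T.adj x (hr 0 hi)
    rcases hadj with h1 | h1
    · have hS : T.Shallow x y := ⟨x, y, h, hy, 0, by omega, rfl, Or.inl ⟨rfl, rfl⟩⟩
      refine absurd (T.eq_of_shallow hα h1 hy (Or.inl fun h2 => ?_) (Or.inr hS)) h.2.1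
      have e1 := T.dist_par x
      have e2 := T.dist_par (T.par x)
      rw [h2] at e2
      omega
    · exact h1
  | succ i ih =>
    have hne := hr (i + 1) hi
    have hadj := T.adj _ hne
    rw [← Function.iterate_succ_apply' T.par] at hadj
    rcases hadj with h1 | h1
    · exfalso
      have hS : T.Shallow (T.par^[i + 1] x) (T.par^[i] x) :=
        ⟨x, y, h, hy, i + 1, hi, rfl, Or.inr ⟨i, rfl, rfl⟩⟩
      have e1 := T.dist_iterate (i + 2) x
      have e3 := T.dist_iterate i x
      have := T.eq_of_shallow hα h1 (ih (by omega)) (Or.inl fun h2 => ?_) (Or.inr hS)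
      · rw [this] at e1
        omega
      · rw [← Function.iterate_succ_apply' T.par] at h2
        have e4 := T.dist_iterate (i + 1) x
        have e2 := T.dist_iterate (i + 1 + 1 + 1) x
        rw [h2] at e2
        omega
    · exact h1

/-- The upward paths of different non-tree edges are disjoint near their owners. -/
theorem iterate_inj (hα : 19 < α) {x y x' y' : V} (h : T.NonTree x y) (hy : y ∈ (s x).1)
    (h' : T.NonTree x' y') (hy' : y' ∈ (s x').1) {i i' : ℕ} (hi : i ≤ 9) (hi' : i' ≤ 9)
    (he : T.par^[i] x = T.par^[i'] x') : x = x' ∧ y = y' ∧ i = i' := by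
  -- Where two paths meet, the vertex owns a shallow edge on each; these coincide, so the meeting
  -- moves down towards the owners.
  induction i generalizing i' with
  | zero =>
    have hS : T.Shallow x y := ⟨x, y, h, hy, 0, hi, rfl, Or.inl ⟨rfl, rfl⟩⟩
    simp only [Function.iterate_zero, id] at he
    cases i' with
    | zero =>
      simp only [Function.iterate_zero, id] at he
      subst he
      exact ⟨rfl, T.eq_of_shallow hα hy hy' (Or.inr hS) (Or.inl h'.2.2), rfl⟩
    | succ j =>
      exfalso
      have h1 := (T.mem_iterate hα h' hy' (i := j) (by omega)).2
      rw [← he] at h1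
      have := T.eq_of_shallow hα hy h1 (Or.inr hS)
        (Or.inr ⟨x', y', h', hy', j + 1, hi', he.symm, Or.inr ⟨j, rfl, rfl⟩⟩)
      refine h.2.2 ?_
      rw [this, he, Function.iterate_succ_apply']
  | succ j ih =>
    have h1 := (T.mem_iterate hα h hy (i := j) (by omega)).2
    cases i' with
    | zero =>
      exfalso
      simp only [Function.iterate_zero, id] at he
      rw [he] at h1
      have := T.eq_of_shallow hα h1 hy'
        (Or.inr ⟨x, y, h, hy, j + 1, hi, he, Or.inr ⟨j, rfl, rfl⟩⟩) (Or.inl h'.2.2)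
      refine h'.2.2 ?_
      rw [← this, ← he, Function.iterate_succ_apply']
    | succ j' =>
      have h2 := (T.mem_iterate hα h' hy' (i := j') (by omega)).2
      rw [← he] at h2
      have := T.eq_of_shallow hα h1 h2
        (Or.inr ⟨x, y, h, hy, j + 1, hi, rfl, Or.inr ⟨j, rfl, rfl⟩⟩)
        (Or.inr ⟨x', y', h', hy', j' + 1, hi', he.symm, Or.inr ⟨j', rfl, rfl⟩⟩)
      obtain ⟨e1, e2, e3⟩ := ih (by omega) (by omega) this
      exact ⟨e1, e2, by omega⟩

end CentralTree

end NetworkCreation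

/-! ### The core and its branching vertices -/

namespace NetworkCreation

namespace CentralTree

variable {V : Type*} [Fintype V] [DecidableEq V] {α : ℝ≥0} {s : Profile V} {r : V}
  (T : CentralTree α s r)

/-- The vertices other than the root that are on the tree path from some end of a non-tree edge
to the root. -/
def Core (z : V) : Prop := z ≠ r ∧ ∃ x y, T.NonTree x y ∧ ∃ k, T.par^[k] x = z

/-- `z` is a lower neighbour of `u` in the core: a child of `u`, or the other end of a non-tree
edge at `u`. -/
def Below (u z : V) : Prop := (T.Core z ∧ T.par z = u) ∨ T.NonTree u z

theorem Core.par {T : CentralTree α s r} {z : V} (h : T.Core z) (hr : T.par z ≠ r) :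
    T.Core (T.par z) := by
  obtain ⟨-, x, y, hxy, k, rfl⟩ := h
  exact ⟨hr, x, y, hxy, k + 1, Function.iterate_succ_apply' _ _ _⟩

theorem core_of_nonTree {x y : V} (h : T.NonTree x y) (hr : x ≠ r) : T.Core x :=
  ⟨hr, x, y, h, 0, rfl⟩

/-- `z` hangs at `w`: the first core vertex on the way from `z` to the root is `w`. -/
def Hangs (w z : V) : Prop := ∃ k, T.par^[k] z = w ∧ ∀ j < k, ¬ T.Core (T.par^[j] z)

theorem hangs_self (w : V) : T.Hangs w w := ⟨0, rfl, by simp⟩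

theorem Hangs.child {T : CentralTree α s r} {w z : V} (h : T.Hangs w (T.par z)) (hz : ¬ T.Core z) :
    T.Hangs w z := by
  obtain ⟨k, hk, hj⟩ := h
  refine ⟨k + 1, hk, fun j hjk => ?_⟩
  cases j with
  | zero => exact hz
  | succ j => exact hj j (by omega)

/-- The part hanging at `w` is joined to the other vertices by core edges at `w` only. -/
theorem eq_of_hangs_of_adj {w p z : V} (hw : T.Core w) (hp : T.Hangs w p) (hz : ¬ T.Hangs w z)
    (h : (graph s).Adj p z) : p = w ∧ (z = T.par w ∨ T.Below w z) := by
  obtain ⟨k, hk, hj⟩ := hp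
  have hpr : p ≠ r := by
    rintro rfl
    rw [T.iterate_root] at hk
    exact hw.1 hk.symm
  have hchild : T.par z = p → T.Core z := by
    intro hzp
    by_contra hc
    exact hz (Hangs.child (hzp ▸ ⟨k, hk, hj⟩) hc)
  cases k with
  | zero =>
    have hpw : p = w := hk
    subst hpw
    refine ⟨rfl, ?_⟩
    by_cases h1 : T.par p = z
    · exact Or.inl h1.symm
    · by_cases h2 : T.par z = p
      · exact Or.inr (Or.inl ⟨hchild h2, h2⟩)
      · exact Or.inr (Or.inr ⟨h, h1, h2⟩)
  | succ k =>
    -- A hanging vertex outside the core meets no non-tree edge and has no core child, so its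
    -- neighbours hang at `w` too.
    exfalso
    have hpc : ¬ T.Core p := hj 0 (by omega)
    by_cases h1 : T.par p = z
    · exact hz ⟨k, h1 ▸ hk, fun j hjk => h1 ▸ hj (j + 1) (by omega)⟩
    · by_cases h2 : T.par z = p
      · exact hpc (h2 ▸ (hchild h2).par (h2 ▸ hpr))
      · exact hpc (T.core_of_nonTree ⟨h, h1, h2⟩ hpr)

/-- If an agent owns the first edge of a descending path whose two interior vertices have degree
two in the core, then its eccentricity is smaller than that of the next vertex: otherwise it would
swap the first edge for an edge to the end of the path. -/
theorem ecc_lt_of_path {w₀ w₁ w₂ w₃ : V} (hown : w₁ ∈ (s w₀).1) (h₁ : T.par w₁ = w₀)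
    (h₂ : T.par w₂ = w₁) (hc₁ : T.Core w₁) (hc₂ : T.Core w₂) (hadj : (graph s).Adj w₂ w₃)
    (hb₁ : ∀ z, T.Below w₁ z → z = w₂) (hb₂ : ∀ z, T.Below w₂ z → z = w₃)
    (hlev : 4 ≤ (graph s).dist r w₁) :
    ecc (graph s) w₀ < ecc (graph s) w₁ := by
  by_contra hlt
  push Not at hlt
  have hl1 := T.dist_eq w₁ hc₁.1
  have hl2 := T.dist_eq w₂ hc₂.1
  rw [h₁] at hl1
  rw [h₂] at hl2
  have h01 : w₀ ≠ w₁ := by rintro rfl; omega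
  have h02 : w₀ ≠ w₂ := by rintro rfl; omega
  have h12 : w₁ ≠ w₂ := by rintro rfl; omega
  have hfar : ∀ w z, 3 ≤ (graph s).dist r w →
      ∀ k, T.par^[k] z = w → (k : ℕ) + (graph s).dist r w ≤ ecc (graph s) r := by
    intro w z hw3 k hk
    have := T.dist_iterate k z
    rw [hk] at this
    have := dist_le_ecc (graph s) r z
    omega
  have hcen := T.center w₀
  -- After the swap `w₃`, `w₂`, `w₁` are within 1, 2, 3 of `w₀`. What hangs at `w₁` or `w₂` is close
  -- enough because their levels are at least 4 and 5.
  have hd := T.nash.deviation T.connected (v := w₀) (X := {w₁}) (by simpa using hown) {w₃}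
    (ecc (graph s) w₀ - 1) ?_
  · have hpos : 1 ≤ ecc (graph s) w₀ := by
      have := dist_le_ecc (graph s) r w₁
      omega
    rw [Nat.cast_sub hpos] at hd
    simp only [Finset.card_singleton] at hd
    push_cast at hd
    linarith
  · intro G' hk ha z
    have hk' : ∀ p q, (graph s).Adj p q → p ≠ w₁ → q ≠ w₁ → G'.Adj p q := fun p q h hp hq =>
      hk p q h (fun _ => by simpa using hq) fun _ => by simpa using hp
    have e3 : G'.edist w₀ w₃ ≤ (1 : ℕ) := by
      by_cases h : w₃ = w₀
      · subst h; simp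
      · exact (SimpleGraph.edist_eq_one_iff_adj.2 (ha w₃ (by simp) h)).le
    have e2 : G'.edist w₀ w₂ ≤ (2 : ℕ) := by
      by_cases h : w₃ = w₁
      · subst h
        refine edist_le_mono (edist_le_succ_of_adj (hk _ _ hadj.symm (fun h => absurd h h01.symm)
          fun h => absurd h h02.symm) e3) (by omega)
      · exact edist_le_succ_of_adj (hk' _ _ hadj.symm h h12.symm) e3
    have e1 : G'.edist w₀ w₁ ≤ (3 : ℕ) := by
      have h := T.adj w₂ hc₂.1
      rw [h₂] at h
      exact edist_le_succ_of_adj (hk _ _ h.symm (fun h => absurd h h02.symm)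
        fun h => absurd h h01.symm) e2
    have ehang : ∀ w, T.Core w → ∀ c : ℕ, G'.edist w₀ w ≤ c → ∀ k z, T.par^[k] z = w →
        (∀ j < k, ¬ T.Core (T.par^[j] z)) → G'.edist w₀ z ≤ (c + k : ℕ) := by
      intro w hw c hc k
      induction k with
      | zero => rintro z rfl -; exact hc
      | succ k ih =>
        intro z hz hj
        have hzr : z ≠ r := by
          rintro rfl
          rw [T.iterate_root] at hz
          exact hw.1 hz.symm
        have hz1 : z ≠ w₁ := by
          rintro rfl
          exact hj 0 (by omega) hc₁
        have hz0 : z = w₀ → T.par z ≠ w₁ := by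
          rintro rfl h
          have := T.dist_par z
          rw [h] at this
          omega
        refine edist_le_succ_of_adj (hk _ _ (T.adj z hzr) (fun _ => by simpa using hz1)
          (fun h => by simpa using hz0 h)) (ih (T.par z) hz fun j hjk => hj (j + 1) (by omega))
    obtain ⟨B₁⟩ := exists_bfsTree T.connected w₁
    -- A shortest path from `w₁` to any other vertex leaves the hanging parts through `w₀` or `w₃`,
    -- and from there `w₀` gains at least one step.
    have hmain : ∀ z, ¬ T.Hangs w₁ z → ¬ T.Hangs w₂ z →
        G'.edist w₀ z ≤ ((graph s).dist w₁ z - 1 : ℕ) := by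
      intro z
      induction z using B₁.induction with
      | root => exact fun h => absurd (T.hangs_self w₁) h
      | step z hz ih =>
        intro hz1 hz2
        have hBadj := B₁.adj z hz
        have hBd := B₁.dist_eq z hz
        by_cases hp1 : T.Hangs w₁ (B₁.par z)
        · obtain ⟨hpw, h | h⟩ := T.eq_of_hangs_of_adj hc₁ hp1 hz1 hBadj
          · rw [h, h₁]; simp
          · rw [hb₁ z h] at hz2
            exact absurd (T.hangs_self w₂) hz2
        · by_cases hp2 : T.Hangs w₂ (B₁.par z)
          · obtain ⟨hpw, h | h⟩ := T.eq_of_hangs_of_adj hc₂ hp2 hz2 hBadj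
            · rw [h, h₂] at hz1
              exact absurd (T.hangs_self w₁) hz1
            · rw [hpw] at hBd
              have := B₁.dist_pos h12.symm
              rw [hb₂ z h] at hBd ⊢
              exact edist_le_mono e3 (by omega)
          · have hpne : B₁.par z ≠ w₁ := fun h => hp1 (by rw [h]; exact T.hangs_self w₁)
            have := B₁.dist_pos hpne
            exact edist_le_mono (edist_le_succ_of_adj (hk' _ _ hBadj hpne hz) (ih hp1 hp2))
              (by omega)
    by_cases hz1 : T.Hangs w₁ z
    · obtain ⟨k, hkz, hj⟩ := hz1
      have := hfar w₁ z (by omega) k hkz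
      exact edist_le_mono (ehang w₁ hc₁ 3 e1 k z hkz hj) (by omega)
    by_cases hz2 : T.Hangs w₂ z
    · obtain ⟨k, hkz, hj⟩ := hz2
      have := hfar w₂ z (by omega) k hkz
      exact edist_le_mono (ehang w₂ hc₂ 2 e2 k z hkz hj) (by omega)
    have := dist_le_ecc (graph s) w₁ z
    exact edist_le_mono (hmain z hz1 hz2) (by omega)

/-- Among four consecutive vertices above the owner of a non-tree edge there is one with two lower
neighbours in the core. -/
theorem exists_branch (hα : 19 < α) {x y : V} (h : T.NonTree x y) (hy : y ∈ (s x).1) {i : ℕ}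
    (hi : i ≤ 5) : ∃ j < 4, ∃ z₁ z₂, z₁ ≠ z₂ ∧ T.Below (T.par^[i + j] x) z₁ ∧
      T.Below (T.par^[i + j] x) z₂ := by
  by_contra hcon
  push Not at hcon
  have hlev : 20 ≤ (graph s).dist r x := by
    have hα' : (19 : ℝ) < α := by exact_mod_cast hα
    have h1 := T.le_dist_of_nonTree h hy
    have : ((19 : ℕ) : ℝ) < (graph s).dist r x := by push_cast; linarith
    exact_mod_cast this
  have hcore : ∀ i ≤ 9, T.Core (T.par^[i] x) := fun i hi =>
    ⟨(T.mem_iterate hα h hy hi).1, x, y, h, i, rfl⟩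
  have hbelow : ∀ i ≤ 8, T.Below (T.par^[i + 1] x) (T.par^[i] x) := fun i hi =>
    Or.inl ⟨hcore i (by omega), (Function.iterate_succ_apply' _ _ _).symm⟩
  have huniq : ∀ j < 4, ∀ z z', T.Below (T.par^[i + j] x) z → T.Below (T.par^[i + j] x) z' →
      z = z' := by
    intro j hj z z' hz hz'
    by_contra hne
    exact hcon j hj z z' hne hz hz'
  obtain ⟨y', hy', hadj'⟩ : ∃ y', T.Below (T.par^[i] x) y' ∧ (graph s).Adj (T.par^[i] x) y' := by
    cases i with
    | zero => exact ⟨y, Or.inr h, h.1⟩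
    | succ i =>
      refine ⟨_, hbelow i (by omega), ?_⟩
      rw [Function.iterate_succ_apply']
      exact T.adj _ (hcore i (by omega)).1
  have hstep : ∀ j, 1 ≤ j → j < 4 → ecc (graph s) (T.par^[i + j + 1] x) <
      ecc (graph s) (T.par^[i + j] x) := by
    intro j hj1 hj4
    obtain ⟨j, rfl⟩ : ∃ l, j = l + 1 := ⟨j - 1, by omega⟩
    obtain ⟨w₃, hw₃, hadj⟩ : ∃ w₃, T.Below (T.par^[i + j] x) w₃ ∧
        (graph s).Adj (T.par^[i + j] x) w₃ := by
      cases j with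
      | zero => exact ⟨y', hy', hadj'⟩
      | succ j =>
        refine ⟨_, hbelow (i + j) (by omega), ?_⟩
        rw [← add_assoc, Function.iterate_succ_apply']
        exact T.adj _ (hcore (i + j) (by omega)).1
    refine T.ecc_lt_of_path (T.mem_iterate hα h hy (i := i + (j + 1)) (by omega)).2
      (Function.iterate_succ_apply' _ _ _).symm (Function.iterate_succ_apply' T.par (i + j) x).symm
      (hcore _ (by omega)) (hcore _ (by omega)) hadj
      (fun z hz => huniq (j + 1) hj4 _ _ hz (hbelow (i + j) (by omega)))
      (fun z hz => huniq j (by omega) _ _ hz hw₃) ?_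
    rw [T.dist_iterate]
    omega
  -- Three strict drops put the eccentricity of `T.par^[i + 1] x` at least 3 above the minimum; `hx`
  -- and `hlast` allow only 2.
  have s1 : ecc (graph s) (T.par^[i + 2] x) < ecc (graph s) (T.par^[i + 1] x) :=
    hstep 1 (by omega) (by omega)
  have s2 : ecc (graph s) (T.par^[i + 3] x) < ecc (graph s) (T.par^[i + 2] x) :=
    hstep 2 (by omega) (by omega)
  have s3 := hstep 3 (by omega) (by omega)
  have hc := T.center (T.par^[i + 3 + 1] x)
  have hx := T.ecc_le_of_nonTree h hy
  obtain ⟨Bx⟩ := exists_bfsTree T.connected x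
  have hlast : ecc (graph s) (T.par^[i + 1] x) ≤ ecc (graph s) x + 1 := by
    refine T.nash.ecc_le_of_par_ne T.connected Bx (T.mem_iterate hα h hy (i := i) (by omega)).2 ?_
    intro hpar
    -- Seen from `x`, the upper end of the edge is farther than the lower one, so it is not its
    -- parent in `Bx`.
    have hdist : ∀ k, (graph s).dist x (T.par^[k] x) ≤ k := by
      intro k
      have h1 := T.edist_iterate_le T.adj k x
      rw [← (T.connected _ _).coe_dist_eq_edist] at h1
      exact_mod_cast h1
    have h1 := hdist i
    have h2 := T.connected.dist_triangle (u := r) (v := T.par^[i + 1] x) (w := x)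
    rw [T.dist_iterate, SimpleGraph.dist_comm (u := T.par^[i + 1] x)] at h2
    have h3 := Bx.dist_par (T.par^[i] x)
    rw [hpar] at h3
    omega
  omega

end CentralTree

end NetworkCreation

/-! ### Double counting: equilibrium graphs are trees -/

namespace NetworkCreation

namespace CentralTree

variable {V : Type*} [Fintype V] [DecidableEq V] {α : ℝ≥0} {s : Profile V} {r : V}
  (T : CentralTree α s r)

theorem exists_below {u : V} (hu : T.Core u) : ∃ z, T.Below u z := by
  obtain ⟨hur, x, y, hxy, k, rfl⟩ := hu
  cases k with
  | zero => exact ⟨y, Or.inr hxy⟩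
  | succ k =>
    refine ⟨T.par^[k] x, Or.inl ⟨⟨?_, x, y, hxy, k, rfl⟩, (Function.iterate_succ_apply' _ _ _).symm⟩⟩
    intro h
    rw [Function.iterate_succ_apply', h, T.par_root] at hur
    exact hur rfl

open Classical in
/-- Double counting of the lower neighbours in the core. -/
theorem sum_card_below_lt {x y : V} (h : T.NonTree x y) (hx : x ≠ r) :
    ∑ u with T.Core u, (Finset.univ.filter (T.Below u)).card <
      (Finset.univ.filter T.Core).card +
        (Finset.univ.filter fun p : V × V => T.NonTree p.1 p.2).card := by
  have h1 : ∀ u, (Finset.univ.filter (T.Below u)).card ≤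
      (Finset.univ.filter fun z => T.Core z ∧ T.par z = u).card +
        (Finset.univ.filter (T.NonTree u)).card := by
    intro u
    refine le_trans (Finset.card_le_card ?_) (Finset.card_union_le _ _)
    intro z hz
    simpa [Below] using hz
  have h2 : ∑ u with T.Core u, (Finset.univ.filter fun z => T.Core z ∧ T.par z = u).card <
      (Finset.univ.filter T.Core).card := by
    rw [← Finset.card_sigma]
    -- A core child of the root has its parent outside the core and is not counted; this makes the
    -- inequality strict.
    obtain ⟨c, hc, hcr⟩ : ∃ c, T.Core c ∧ T.par c = r := by
      have hpos := T.dist_pos hx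
      refine ⟨T.par^[(graph s).dist r x - 1] x, ⟨?_, x, y, h, _, rfl⟩, ?_⟩
      · intro he
        have := T.dist_iterate ((graph s).dist r x - 1) x
        rw [he] at this
        simp at this
        omega
      · refine T.toBFSTree.eq_root_of_dist_eq_zero ?_
        rw [T.dist_par, T.dist_iterate]
        omega
    have h3 : ((Finset.univ.filter T.Core).erase c).card + 1 = (Finset.univ.filter T.Core).card :=
      Finset.card_erase_add_one (by simpa using hc)
    refine Nat.lt_of_le_of_lt (Finset.card_le_card_of_injOn (t := (Finset.univ.filter T.Core).erase c)
      (fun q => q.2) ?_ ?_) (by omega)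
    · rintro ⟨u, z⟩ hq
      simp only [Finset.coe_sigma, Set.mem_sigma_iff, Finset.mem_coe, Finset.mem_filter,
        Finset.mem_univ, true_and] at hq
      simp only [Finset.coe_erase, Finset.coe_filter, Finset.mem_univ, true_and, Set.mem_sdiff,
        Set.mem_ofPred_eq, Set.mem_singleton_iff]
      refine ⟨hq.2.1, ?_⟩
      rintro rfl
      exact hq.1.1 (hq.2.2.symm.trans hcr)
    · rintro ⟨u, z⟩ hq ⟨u', z'⟩ hq' he
      simp only [Finset.coe_sigma, Set.mem_sigma_iff, Finset.mem_coe, Finset.mem_filter,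
        Finset.mem_univ, true_and] at hq hq' he
      subst he
      obtain rfl : u = u' := hq.2.2.symm.trans hq'.2.2
      rfl
  have h3 : ∑ u with T.Core u, (Finset.univ.filter (T.NonTree u)).card ≤
      (Finset.univ.filter fun p : V × V => T.NonTree p.1 p.2).card := by
    rw [← Finset.card_sigma]
    refine Finset.card_le_card_of_injOn (fun q => (q.1, q.2)) ?_ ?_
    · rintro ⟨u, z⟩ hq
      simp only [Finset.coe_sigma, Set.mem_sigma_iff, Finset.mem_coe, Finset.mem_filter,
        Finset.mem_univ, true_and] at hq
      simpa using hq.2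
    · rintro ⟨u, z⟩ _ ⟨u', z'⟩ _ he
      simp only [Prod.mk.injEq] at he
      obtain ⟨rfl, rfl⟩ := he
      rfl
  calc _ ≤ ∑ u with T.Core u, ((Finset.univ.filter fun z => T.Core z ∧ T.par z = u).card +
        (Finset.univ.filter (T.NonTree u)).card) := Finset.sum_le_sum fun u _ => h1 u
    _ < _ := by rw [Finset.sum_add_distrib]; exact add_lt_add_of_lt_of_le h2 h3

open Classical in
/-- To every non-tree edge belong two vertices with two lower neighbours in the core, and these
are different for different edges. -/
theorem two_mul_card_le (hα : 19 < α) :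
    2 * (Finset.univ.filter fun p : V × V => T.NonTree p.1 p.2 ∧ p.2 ∈ (s p.1).1).card ≤
      ((Finset.univ.filter T.Core).filter
        fun u => 2 ≤ (Finset.univ.filter (T.Below u)).card).card := by
  -- Two disjoint windows of four vertices above each owner, steps 0 to 3 and 4 to 7.
  have hex : ∀ (p : V × V) (t : Fin 2), T.NonTree p.1 p.2 ∧ p.2 ∈ (s p.1).1 →
      ∃ j < 4, 2 ≤ (Finset.univ.filter (T.Below (T.par^[4 * t.1 + j] p.1))).card := by
    intro p t hp
    obtain ⟨j, hj, z₁, z₂, hne, h1, h2⟩ := T.exists_branch hα hp.1 hp.2 (i := 4 * t.1) (by omega)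
    refine ⟨j, hj, ?_⟩
    refine (Finset.card_pair hne).ge.trans (Finset.card_le_card ?_)
    intro z hz
    simp only [Finset.mem_insert, Finset.mem_singleton] at hz
    rcases hz with rfl | rfl <;> simpa
  choose! f hf hf' using hex
  have : 2 * (Finset.univ.filter fun p : V × V => T.NonTree p.1 p.2 ∧ p.2 ∈ (s p.1).1).card =
      ((Finset.univ.filter fun p : V × V => T.NonTree p.1 p.2 ∧ p.2 ∈ (s p.1).1) ×ˢ
        (Finset.univ : Finset (Fin 2))).card := by
    rw [Finset.card_product, Finset.card_univ, Fintype.card_fin, mul_comm]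
  rw [this]
  refine Finset.card_le_card_of_injOn (fun q => T.par^[4 * q.2.1 + f q.1 q.2] q.1.1) ?_ ?_
  · rintro ⟨p, t⟩ hq
    have hp : T.NonTree p.1 p.2 ∧ p.2 ∈ (s p.1).1 := by simpa using hq
    have hft := hf p t hp
    simp only [Finset.coe_filter, Set.mem_ofPred_eq, Finset.mem_filter, Finset.mem_univ, true_and]
    exact ⟨⟨(T.mem_iterate hα hp.1 hp.2 (by omega)).1, _, _, hp.1, _, rfl⟩, hf' p t hp⟩
  · rintro ⟨p, t⟩ hq ⟨p', t'⟩ hq' he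
    have hp : T.NonTree p.1 p.2 ∧ p.2 ∈ (s p.1).1 := by simpa using hq
    have hp' : T.NonTree p'.1 p'.2 ∧ p'.2 ∈ (s p'.1).1 := by simpa using hq'
    have hft := hf p t hp
    have hft' := hf p' t' hp'
    have he' : T.par^[4 * t.1 + f p t] p.1 = T.par^[4 * t'.1 + f p' t'] p'.1 := he
    obtain ⟨e1, e2, e3⟩ := T.iterate_inj hα hp.1 hp.2 hp'.1 hp'.2 (by omega) (by omega) he'
    rw [Prod.mk.injEq]
    exact ⟨Prod.ext e1 e2, Fin.ext (by omega)⟩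

/-- For `α > 19` equilibrium graphs are trees. -/
theorem not_nonTree (hα : 19 < α) (x y : V) : ¬ T.NonTree x y := by
  classical
  intro h
  obtain ⟨x, y, h, hy⟩ : ∃ x y, T.NonTree x y ∧ y ∈ (s x).1 := by
    rcases h.1 with h1 | h1
    · exact ⟨y, x, h.symm, h1⟩
    · exact ⟨x, y, h, h1⟩
  have h1 := T.sum_card_below_lt h (T.mem_iterate hα h hy (Nat.zero_le 9)).1
  have h2 := T.two_mul_card_le hα
  have h3 : (Finset.univ.filter fun p : V × V => T.NonTree p.1 p.2).card ≤
      2 * (Finset.univ.filter fun p : V × V => T.NonTree p.1 p.2 ∧ p.2 ∈ (s p.1).1).card := by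
    rw [two_mul]
    nth_rewrite 2 [← Finset.card_image_of_injective _ Prod.swap_injective]
    refine le_trans (Finset.card_le_card ?_) (Finset.card_union_le _ _)
    rintro ⟨a, b⟩ hab
    simp only [Finset.mem_filter, Finset.mem_univ, true_and] at hab
    simp only [Finset.mem_union, Finset.mem_filter, Finset.mem_univ, true_and, Finset.mem_image]
    rcases hab.1 with h1 | h1
    · exact Or.inl ⟨(b, a), ⟨hab.symm, h1⟩, rfl⟩
    · exact Or.inr ⟨hab, h1⟩
  -- Every core vertex has one lower neighbour, a branching one at least one more.
  have h4 : (Finset.univ.filter T.Core).card + ((Finset.univ.filter T.Core).filter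
      fun u => 2 ≤ (Finset.univ.filter (T.Below u)).card).card ≤
      ∑ u with T.Core u, (Finset.univ.filter (T.Below u)).card := by
    rw [Finset.card_filter (fun u => 2 ≤ (Finset.univ.filter (T.Below u)).card),
      Finset.card_eq_sum_ones, ← Finset.sum_add_distrib]
    refine Finset.sum_le_sum fun u hu => ?_
    have : 0 < (Finset.univ.filter (T.Below u)).card := by
      obtain ⟨z, hz⟩ := T.exists_below (Finset.mem_filter.1 hu).2
      exact Finset.card_pos.2 ⟨z, by simpa using hz⟩
    split_ifs <;> omega
  omega

end CentralTree

end NetworkCreation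

/-! ### The cost of tree equilibria -/

namespace NetworkCreation

variable {V : Type*} [Fintype V] [DecidableEq V] {α : ℝ≥0} {s : Profile V} {r : V}

theorem exists_dist_eq_ecc (G : SimpleGraph V) (v : V) : ∃ z, G.dist v z = ecc G v := by
  obtain ⟨z, -, hz⟩ := Finset.exists_mem_eq_sup Finset.univ ⟨v, Finset.mem_univ v⟩ (G.dist v)
  exact ⟨z, hz.symm⟩

/-- In an equilibrium no edge is paid for twice. -/
theorem IsNash.notMem_of_mem (hs : IsNash α s) (hG : (graph s).Connected) (hα : 0 < α) {v w : V}
    (h : w ∈ (s v).1) : v ∉ (s w).1 := by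
  intro hw
  let s' : Profile V := Function.update s v ⟨(s v).1.erase w, fun h => (s v).2
    (Finset.mem_of_mem_erase h)⟩
  have hsv : (s' v).1 = (s v).1.erase w := by simp [s']
  have hsu : ∀ u, u ≠ v → s' u = s u := fun u hu => Function.update_of_ne hu _ _
  have hwv : w ≠ v := by rintro rfl; exact (s w).2 h
  have hmem : ∀ a b, a ∈ (s b).1 → a ∈ (s' b).1 ∨ b ∈ (s' a).1 := by
    intro a b hab
    by_cases hb : b = v
    · subst hb
      by_cases ha : a = w
      · subst ha
        exact Or.inr (by rw [hsu a hwv]; exact hw)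
      · exact Or.inl (by rw [hsv]; exact Finset.mem_erase.2 ⟨ha, hab⟩)
    · exact Or.inl (by rw [hsu b hb]; exact hab)
  have hle : graph s ≤ graph s' := by
    intro a b hab
    rcases hab with h1 | h1
    · exact hmem _ _ h1
    · exact (hmem _ _ h1).symm
  have h1 := hs v s' hsu
  have h2 : agentCost α s' v ≤ _ := agentCost_le (b := ecc (graph s) v) α fun z => by
    refine (SimpleGraph.edist_anti hle).trans ?_
    rw [← (hG v z).coe_dist_eq_edist]
    exact_mod_cast dist_le_ecc _ _ _
  rw [agentCost_of_connected hG] at h1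
  have h3 := ENNReal.coe_le_coe.1 (h1.trans h2)
  rw [hsv] at h3
  have h4 : α * ((s v).1.card : ℝ≥0) ≤ α * ((s v).1.erase w).card := le_of_add_le_add_right h3
  have h5 := le_of_mul_le_mul_left h4 hα
  have h6 : (s v).1.card ≤ ((s v).1.erase w).card := by exact_mod_cast h5
  have h7 := Finset.card_erase_lt_of_mem h
  omega

namespace CentralTree

variable (T : CentralTree α s r)

/-- In a tree at most `|V| - 1` edges are paid for. -/
theorem sum_card_lt (hα : 0 < α) (htree : ∀ x y, ¬ T.NonTree x y) :
    ∑ v, (s v).1.card < Fintype.card V := by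
  rw [← Finset.card_sigma, ← Finset.card_univ]
  have h3 : ((Finset.univ : Finset V).erase r).card + 1 = (Finset.univ : Finset V).card :=
    Finset.card_erase_add_one (Finset.mem_univ r)
  have hcases : ∀ v w, w ∈ (s v).1 → (T.par w = v ∧ w ≠ r) ∨ (T.par w ≠ v ∧ T.par v = w ∧ v ≠ r) := by
    intro v w hw
    have hadj : (graph s).Adj v w := Or.inr hw
    by_cases h1 : T.par w = v
    · refine Or.inl ⟨h1, ?_⟩
      rintro rfl
      rw [T.par_root] at h1
      exact hadj.ne h1.symm
    · have h2 : T.par v = w := by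
        by_contra h2
        exact htree v w ⟨hadj, h2, h1⟩
      refine Or.inr ⟨h1, h2, ?_⟩
      rintro rfl
      rw [T.par_root] at h2
      exact hadj.ne h2
  -- Each purchase is charged to the lower end of its edge, which is never the root.
  refine Nat.lt_of_le_of_lt (Finset.card_le_card_of_injOn (t := Finset.univ.erase r)
    (fun q => if T.par q.2 = q.1 then q.2 else q.1) ?_ ?_) (by omega)
  · rintro ⟨v, w⟩ hq
    have hw : w ∈ (s v).1 := by simpa using hq
    rcases hcases v w hw with ⟨h1, h2⟩ | ⟨h1, h2, h4⟩
    · simp [h1, h2]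
    · simp [h1, h4]
  · rintro ⟨v, w⟩ hq ⟨v', w'⟩ hq' he
    have hw : w ∈ (s v).1 := by simpa using hq
    have hw' : w' ∈ (s v').1 := by simpa using hq'
    have hno : ∀ a b, ¬ (a ∈ (s b).1 ∧ b ∈ (s a).1) := fun a b h =>
      T.nash.notMem_of_mem T.connected hα h.1 h.2
    rcases hcases v w hw with ⟨h1, -⟩ | ⟨h1, h2, -⟩ <;>
      rcases hcases v' w' hw' with ⟨h1', -⟩ | ⟨h1', h2', -⟩ <;>
      simp only [h1, h1', if_true, if_false] at he
    · subst he
      rw [← h1, ← h1']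
    · subst he
      rw [h1] at h2'
      subst h2'
      exact absurd ⟨hw, hw'⟩ (hno _ _)
    · subst he
      rw [h2] at h1'
      subst h1'
      exact absurd ⟨hw, hw'⟩ (hno _ _)
    · subst he
      rw [← h2, ← h2']

theorem ecc_le_root_add (T : CentralTree α s r) (v : V) :
    (ecc (graph s) v : ℝ) ≤ ecc (graph s) r + 1 + α := by
  have h := T.nash.deviation T.connected (v := v) (X := ∅) (by simp) {r} (ecc (graph s) r + 1) ?_
  · simp only [Finset.card_empty, Finset.card_singleton] at h
    push_cast at h
    linarith
  · intro G' hk ha z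
    have hroot : G'.edist v r ≤ (1 : ℕ) := by
      by_cases hr : r = v
      · subst hr; simp
      · exact (SimpleGraph.edist_eq_one_iff_adj.2 (ha r (by simp) hr)).le
    have h2 := T.edist_root_le (G' := G') (fun z hz => hk _ _ (T.adj z hz) (by simp) (by simp)) z
    have := dist_le_ecc (graph s) r z
    exact edist_le_mono (edist_le_add hroot h2) (by omega)

/-- The radius of a tree in equilibrium. -/
theorem ecc_root_le (htree : ∀ x y, ¬ T.NonTree x y) : (ecc (graph s) r : ℝ) ≤ α + 2 := by
  have hα0 : (0 : ℝ) ≤ α := α.2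
  obtain ⟨f, hf⟩ := exists_dist_eq_ecc (graph s) r
  rcases Nat.eq_zero_or_pos (ecc (graph s) r) with h0 | hpos
  · rw [h0]; push_cast; linarith
  set R := ecc (graph s) r with hR
  -- The child `c` of the root towards the farthest vertex `f` is no more central than `r`, so some
  -- `z` not below `c` has level at least `R - 1`. The path from `f` to `z` passes through `r`.
  set c := T.par^[R - 1] f with hc
  have hcl : (graph s).dist r c = 1 := by rw [hc, T.dist_iterate]; omega
  have hcr : c ≠ r := by intro h; rw [h] at hcl; simp at hcl
  have hpc : T.par c = r := T.toBFSTree.eq_root_of_dist_eq_zero (by rw [T.dist_par]; omega)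
  obtain ⟨z, hz⟩ := exists_dist_eq_ecc (graph s) c
  have hcz := T.center c
  have hzR := dist_le_ecc (graph s) r z
  have hznd : ∀ k, T.par^[k] z ≠ c := by
    intro k hk
    have h1 := T.iterate_level hk
    have h2 := T.edist_iterate_le T.adj ((graph s).dist r z - (graph s).dist r c) z
    rw [h1, ← (T.connected _ _).coe_dist_eq_edist, SimpleGraph.dist_comm] at h2
    have h3 : (graph s).dist c z ≤ (graph s).dist r z - (graph s).dist r c := by exact_mod_cast h2
    omega
  have hzl : R ≤ (graph s).dist r z + 1 := by
    have h1 := T.connected.dist_triangle (u := c) (v := r) (w := z)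
    rw [SimpleGraph.dist_comm (u := c) (v := r), hcl] at h1
    omega
  obtain ⟨Bf⟩ := exists_bfsTree T.connected f
  classical
  -- The signed level, negative below `c`, grows by at most 1 along every edge and is `-R` at `f`.
  have hpot : ∀ v, (if ∃ k, T.par^[k] v = c then -((graph s).dist r v : ℤ)
      else (graph s).dist r v) + R ≤ (graph s).dist f v := by
    intro v
    induction v using Bf.induction with
    | root => rw [if_pos ⟨R - 1, hc.symm⟩, hf]; simp
    | step v hv ih =>
      have hadj := Bf.adj v hv
      rw [Bf.dist_eq v hv]
      push_cast
      refine le_trans ?_ (add_le_add_left ih 1)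
      set p := Bf.par v
      by_cases h1 : T.par v = p
      · have hvr : v ≠ r := by
          rintro rfl
          rw [T.par_root] at h1
          exact hadj.ne h1.symm
        have hl := T.dist_eq v hvr
        rw [h1] at hl
        by_cases hp : ∃ k, T.par^[k] p = c
        · have hvd : ∃ k, T.par^[k] v = c := by
            obtain ⟨k, hk⟩ := hp
            exact ⟨k + 1, by rw [Function.iterate_succ_apply, h1]; exact hk⟩
          rw [if_pos hp, if_pos hvd]
          omega
        · rw [if_neg hp]
          split_ifs <;> omega
      · have h2 : T.par p = v := by
          by_contra h2
          exact htree v p ⟨hadj.symm, h1, h2⟩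
        have hpr : p ≠ r := by
          intro h
          rw [h, T.par_root] at h2
          rw [h, h2] at hadj
          exact hadj.ne rfl
        have hl := T.dist_eq p hpr
        rw [h2] at hl
        by_cases hvd : ∃ k, T.par^[k] v = c
        · have hp : ∃ k, T.par^[k] p = c := by
            obtain ⟨k, hk⟩ := hvd
            exact ⟨k + 1, by rw [Function.iterate_succ_apply, h2]; exact hk⟩
          rw [if_pos hp, if_pos hvd]
          omega
        · rw [if_neg hvd]
          by_cases hp : ∃ k, T.par^[k] p = c
          · obtain ⟨k, hk⟩ := hp
            cases k with
            | zero =>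
              have hpc' : p = c := hk
              rw [if_pos ⟨0, hk⟩]
              rw [hpc', hcl] at hl
              rw [hpc', hcl]
              omega
            | succ k =>
              rw [Function.iterate_succ_apply, h2] at hk
              exact absurd ⟨k, hk⟩ hvd
          · rw [if_neg hp]
            omega
  have h1 := hpot z
  rw [if_neg (by push Not; exact hznd)] at h1
  have h2 := dist_le_ecc (graph s) f z
  have h3 := T.ecc_le_root_add f
  have h4 : 2 * R ≤ ecc (graph s) f + 1 := by omega
  have h5 : 2 * (R : ℝ) ≤ ecc (graph s) f + 1 := by exact_mod_cast h4
  rw [← hR] at h3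
  linarith

/-- The distance costs of a tree in equilibrium. -/
theorem sum_ecc_le [Nontrivial V] (htree : ∀ x y, ¬ T.NonTree x y) :
    ∑ v, (ecc (graph s) v : ℝ) + 1 ≤ 2 * α * (Fintype.card V - 1) + 3 * Fintype.card V := by
  have hR := T.ecc_root_le htree
  -- The bound `2 * α + 3` serves for all but the root and one neighbour, which have eccentricities
  -- at most `R` and `R + 1`.
  obtain ⟨v, hv⟩ := exists_ne r
  set c := T.par^[(graph s).dist r v - 1] v with hc
  have hcl : (graph s).dist r c = 1 := by
    have := T.dist_pos hv
    rw [hc, T.dist_iterate]; omega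
  have hcr : c ≠ r := by intro h; rw [h] at hcl; simp at hcl
  have hcecc : ecc (graph s) c ≤ ecc (graph s) r + 1 := ecc_le fun z => by
    have h1 := T.connected.dist_triangle (u := c) (v := r) (w := z)
    rw [SimpleGraph.dist_comm (u := c) (v := r), hcl] at h1
    have := dist_le_ecc (graph s) r z
    omega
  have hcecc' : (ecc (graph s) c : ℝ) ≤ ecc (graph s) r + 1 := by exact_mod_cast hcecc
  have hsub : ({r, c} : Finset V) ⊆ Finset.univ := Finset.subset_univ _
  have hcard : (Finset.univ \ {r, c} : Finset V).card + 2 = Fintype.card V := by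
    rw [← Finset.card_pair hcr.symm, Finset.card_sdiff_add_card_eq_card hsub, Finset.card_univ]
  have hcard' : ((Finset.univ \ {r, c} : Finset V).card : ℝ) = Fintype.card V - 2 := by
    rw [← hcard]; push_cast; ring
  have hsum : ∑ v ∈ Finset.univ \ {r, c}, (ecc (graph s) v : ℝ) ≤
      (Finset.univ \ {r, c} : Finset V).card • (2 * (α : ℝ) + 3) :=
    Finset.sum_le_card_nsmul _ _ _ fun v _ => by
      have := T.ecc_le_root_add v
      linarith
  rw [← Finset.sum_sdiff hsub, Finset.sum_pair hcr.symm]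
  rw [nsmul_eq_mul, hcard'] at hsum
  nlinarith

/-- The spare 1, uniform over all equilibria, makes the final ratio strictly less than 3. -/
theorem socialCost_add_one_le (T : CentralTree α s r) [Nontrivial V] (hα : 19 < α) {m : ℕ} (hm : Fintype.card V = m + 1) :
    socialCost α s + 1 ≤ 3 * ((α * m + (m + 1) : ℝ≥0) : ℝ≥0∞) := by
  have htree := T.not_nonTree hα
  have h1 := T.sum_card_lt (lt_trans (by norm_num) hα) htree
  have h2 := T.sum_ecc_le htree
  rw [socialCost, Finset.sum_congr rfl fun v _ => agentCost_of_connected T.connected α v]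
  have h3 : ∑ v, (s v).1.card ≤ m := by omega
  have h4 : ((∑ v, (s v).1.card : ℕ) : ℝ) ≤ m := by exact_mod_cast h3
  have h5 : (∑ v, (α * (s v).1.card + ecc (graph s) v) : ℝ≥0) + 1 ≤ 3 * (α * m + (m + 1)) := by
    rw [← NNReal.coe_le_coe]
    push_cast
    rw [Finset.sum_add_distrib, ← Finset.mul_sum]
    rw [hm] at h2
    push_cast at h2 h4
    have := mul_le_mul_of_nonneg_left h4 (NNReal.coe_nonneg α)
    linarith
  exact_mod_cast h5

end CentralTree

theorem IsNash.exists_centralTree [Nonempty V] (hs : IsNash α s) :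
    ∃ r, Nonempty (CentralTree α s r) := by
  obtain ⟨r, hr⟩ := Finite.exists_min (ecc (graph s))
  obtain ⟨B⟩ := exists_bfsTree hs.connected r
  exact ⟨r, ⟨⟨B, hs, hs.connected, hr⟩⟩⟩

theorem worstNashCost_add_one_le [Nontrivial V] (hα : 19 < α) {m : ℕ}
    (hm : Fintype.card V = m + 1) :
    worstNashCost V α + 1 ≤ 3 * ((α * m + (m + 1) : ℝ≥0) : ℝ≥0∞) := by
  have h1 : (1 : ℝ≥0∞) ≤ 3 * ((α * m + (m + 1) : ℝ≥0) : ℝ≥0∞) := by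
    have : (1 : ℝ≥0) ≤ 3 * (α * m + (m + 1)) := by
      rw [← NNReal.coe_le_coe]
      push_cast
      have : (0 : ℝ) ≤ α * m := by positivity
      have : (0 : ℝ) ≤ m := by positivity
      linarith
    exact_mod_cast this
  rw [← tsub_add_cancel_of_le h1]
  gcongr
  refine iSup₂_le fun s hs => ?_
  obtain ⟨r, ⟨T⟩⟩ := IsNash.exists_centralTree hs
  exact ENNReal.le_sub_of_add_le_right ENNReal.one_ne_top (T.socialCost_add_one_le hα hm)

/-! ### The optimum and the star -/

theorem le_socialCost [Nontrivial V] (α : ℝ≥0) (s : Profile V) {m : ℕ}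
    (hm : Fintype.card V = m + 1) :
    ((α * m + (m + 1) : ℝ≥0) : ℝ≥0∞) ≤ socialCost α s := by
  by_cases hG : (graph s).Connected
  · rw [socialCost, Finset.sum_congr rfl fun v _ => agentCost_of_connected hG α v]
    have h1 : m ≤ ∑ v, (s v).1.card := by
      have h2 := hG.card_vert_le_card_edgeSet_add_one
      -- Every edge is paid for at least once.
      have h3 : Nat.card (graph s).edgeSet ≤ Nat.card (Σ v, (s v).1) := by
        refine Nat.card_le_card_of_surjective (fun q => ⟨s(q.1, q.2.1), Or.inr q.2.2⟩) ?_
        rintro ⟨e, he⟩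
        induction e using Sym2.ind with
        | _ a b =>
          rcases he with h | h
          · exact ⟨⟨b, a, h⟩, Subtype.ext Sym2.eq_swap⟩
          · exact ⟨⟨a, b, h⟩, rfl⟩
      rw [Nat.card_sigma] at h3
      simp only [Nat.card_eq_fintype_card, Fintype.card_coe] at h2 h3
      omega
    have h2 : ∀ v, 1 ≤ ecc (graph s) v := fun v => by
      obtain ⟨z, hz⟩ := exists_ne v
      exact (hG.pos_dist_of_ne hz.symm).trans_le (dist_le_ecc _ _ _)
    have h3 : m + 1 ≤ ∑ v, ecc (graph s) v := by
      have := Finset.card_nsmul_le_sum Finset.univ (ecc (graph s)) 1 fun v _ => h2 v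
      rwa [Finset.card_univ, hm, smul_eq_mul, mul_one] at this
    have h4 : α * m + (m + 1) ≤ ∑ v, (α * (s v).1.card + ecc (graph s) v) := by
      rw [Finset.sum_add_distrib, ← Finset.mul_sum]
      gcongr
      · exact_mod_cast h1
      · exact_mod_cast h3
    exact_mod_cast h4
  · have : ∃ v u, ¬ (graph s).Reachable v u := by
      by_contra h
      push Not at h
      exact hG ⟨h⟩
    obtain ⟨v, u, hvu⟩ := this
    have h1 : (⨆ u, (graph s).edist v u) = ⊤ := by
      refine top_le_iff.1 (le_trans ?_ (le_iSup (fun u => (graph s).edist v u) u))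
      by_contra h
      exact hvu (SimpleGraph.edist_ne_top_iff_reachable.1 fun h' => h h'.ge)
    have h2 : agentCost α s v = ⊤ := by rw [agentCost, h1]; simp
    have h3 : agentCost α s v ≤ socialCost α s :=
      Finset.single_le_sum (f := agentCost α s) (fun _ _ => zero_le) (Finset.mem_univ v)
    rw [h2] at h3
    exact le_top.trans h3

theorem le_agentCost (α : ℝ≥0) (s : Profile V) (v z : V) {k : ℕ}
    (h : (k : ℕ∞) ≤ (graph s).edist v z) :
    ((α * (s v).1.card + k : ℝ≥0) : ℝ≥0∞) ≤ agentCost α s v := by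
  rw [agentCost]
  push_cast
  gcongr
  have : (k : ℕ∞) ≤ ⨆ u, (graph s).edist v u := h.trans (le_iSup (fun u => (graph s).edist v u) z)
  calc ((k : ℕ) : ℝ≥0∞) = ((k : ℕ∞) : ℝ≥0∞) := (ENat.toENNReal_coe k).symm
    _ ≤ _ := ENat.toENNReal_le.2 this

/-- The star in which every leaf pays for its edge to the centre `c`. -/
def star (c : V) : Profile V := fun v => ⟨if v = c then ∅ else {c}, by
  split_ifs with h
  · simp
  · simpa using h⟩

/-- A leaf pays at most α + 2. Two purchases cost 2α ≥ α + 2, a purchase missing the centre leaves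
it at distance at least 2, and none isolates the leaf. -/
theorem isNash_star [Nontrivial V] (hα : 2 ≤ α) (c : V) : IsNash α (star c) := by
  have hadj : ∀ z, z ≠ c → (graph (star c)).Adj c z := fun z hz => Or.inl (by simp [star, hz])
  have hc : ∀ z, (graph (star c)).edist c z ≤ (1 : ℕ) := fun z => by
    by_cases hz : z = c
    · subst hz; simp
    · exact (SimpleGraph.edist_eq_one_iff_adj.2 (hadj z hz)).le
  intro v s' hs'
  by_cases hv : v = c
  · subst hv
    obtain ⟨z, hz⟩ := exists_ne v
    refine (agentCost_le (b := 1) α hc).trans (le_trans ?_ (le_agentCost α s' v z (k := 1) ?_))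
    · refine ENNReal.coe_le_coe.2 ?_
      simp [star]
    · exact Order.one_le_iff_ne_zero.2 fun h => hz (SimpleGraph.edist_eq_zero_iff.1 h).symm
  · have hle : agentCost α (star c) v ≤ ((α + 2 : ℝ≥0) : ℝ≥0∞) := by
      have := agentCost_le (s := star c) (v := v) (b := 2) α fun z => by
        refine edist_le_add (k := 1) (l := 1) (v := c) ?_ (hc z)
        rw [SimpleGraph.edist_comm]
        exact hc v
      simpa [star, hv] using this
    -- Nobody else buys an edge to a leaf, so its neighbours are those it buys.
    have hnb : ∀ u, (graph s').Adj v u → u ∈ (s' v).1 := by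
      rintro u (h | h)
      swap
      · exact h
      · by_cases huv : u = v
        · subst huv; exact absurd h (s' u).2
        · rw [hs' u huv] at h
          exfalso
          by_cases huc : u = c
          · simp [star, huc] at h
          · simp only [star, if_neg huc, Finset.mem_singleton] at h
            exact hv h
    by_cases hcs : c ∈ (s' v).1
    · by_cases hcard : (s' v).1.card ≤ 1
      · have heq : (s' v).1 = {c} := by
          symm
          exact Finset.eq_of_subset_of_card_le (by simpa using hcs) (by simpa using hcard)
        have : s' = star c := by
          funext u
          by_cases huv : u = v
          · subst huv; exact Subtype.ext (by rw [heq]; simp [star, hv])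
          · exact hs' u huv
        rw [this]
      · refine hle.trans (le_trans ?_ (le_agentCost α s' v v (k := 0) (by simp)))
        refine ENNReal.coe_le_coe.2 ?_
        have h2 : (2 : ℝ≥0) ≤ (s' v).1.card := by exact_mod_cast (not_le.1 hcard)
        calc α + 2 ≤ α + α := by gcongr
          _ = α * 2 := by ring
          _ ≤ _ := by push_cast; rw [add_zero]; gcongr
    · have h2 : (2 : ℕ) ≤ (graph s').edist v c := by
        by_contra hlt
        rw [not_le] at hlt
        have h3 : (graph s').edist v c ≤ 1 := Order.le_of_lt_add_one (by
          refine hlt.trans_le ?_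
          norm_num)
        rcases SimpleGraph.edist_le_one_iff_adj_or_eq.1 h3 with h | h
        · exact hcs (hnb c h)
        · exact hv h
      by_cases hemp : (s' v).1 = ∅
      · have : (graph s').edist v c = ⊤ := by
          by_contra hne
          obtain ⟨w⟩ := SimpleGraph.edist_ne_top_iff_reachable.1 hne
          cases w with
          | nil => exact hv rfl
          | cons h _ =>
            have := hnb _ h
            rw [hemp] at this
            simp at this
        have h4 : (⨆ u, (graph s').edist v u) = ⊤ :=
          top_le_iff.1 (this ▸ le_iSup (fun u => (graph s').edist v u) c)
        rw [agentCost, agentCost, h4]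
        simp
      · refine hle.trans (le_trans ?_ (le_agentCost α s' v c h2))
        refine ENNReal.coe_le_coe.2 ?_
        have h5 : (1 : ℝ≥0) ≤ (s' v).1.card := by
          exact_mod_cast Finset.card_pos.2 (Finset.nonempty_iff_ne_empty.2 hemp)
        calc α + 2 = α * 1 + 2 := by ring
          _ ≤ _ := by push_cast; gcongr

theorem optimalCost_lt_top [Nontrivial V] (hα : 2 ≤ α) : optimalCost V α < ⊤ := by
  obtain ⟨c⟩ : Nonempty V := inferInstance
  refine (iInf_le _ (star c)).trans_lt ?_
  rw [socialCost, Finset.sum_congr rfl fun v _ =>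
    agentCost_of_connected (isNash_star hα c).connected α v]
  exact_mod_cast ENNReal.coe_lt_top

end NetworkCreation

theorem corollary1 (n : ℕ) (hn : 2 ≤ n) (α : ℝ≥0) (hα : 19 < α) :
    (∃ s : NetworkCreation.Profile (Fin n), NetworkCreation.IsNash α s) ∧
      0 < NetworkCreation.optimalCost (Fin n) α ∧
      NetworkCreation.optimalCost (Fin n) α < ⊤ ∧
      NetworkCreation.priceOfAnarchy (Fin n) α < 3 := by
  obtain ⟨m, rfl⟩ : ∃ m, n = m + 1 := ⟨n - 1, by omega⟩
  have : Nontrivial (Fin (m + 1)) := Fin.nontrivial_iff_two_le.2 hn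
  have h2 : 2 ≤ α := le_trans (by norm_num) hα.le
  set L : ℝ≥0 := α * m + (m + 1) with hL
  have hlow : (L : ℝ≥0∞) ≤ NetworkCreation.optimalCost (Fin (m + 1)) α :=
    le_iInf fun s => NetworkCreation.le_socialCost α s (by simp)
  have hLpos : (0 : ℝ≥0∞) < L := by
    have : 0 < L := by positivity
    exact_mod_cast this
  have hupp := NetworkCreation.worstNashCost_add_one_le (V := Fin (m + 1)) hα (m := m) (by simp)
  rw [← hL] at hupp
  refine ⟨⟨_, NetworkCreation.isNash_star h2 0⟩, hLpos.trans_le hlow,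
    NetworkCreation.optimalCost_lt_top h2, ?_⟩
  have hfin : NetworkCreation.worstNashCost (Fin (m + 1)) α ≠ ⊤ := by
    intro h
    rw [h, top_add, top_le_iff] at hupp
    exact ENNReal.mul_ne_top (by norm_num) ENNReal.coe_ne_top hupp
  refine ENNReal.div_lt_of_lt_mul ?_
  calc NetworkCreation.worstNashCost (Fin (m + 1)) α
      < NetworkCreation.worstNashCost (Fin (m + 1)) α + 1 :=
        ENNReal.lt_add_right hfin one_ne_zero
    _ ≤ 3 * L := hupp
    _ ≤ 3 * NetworkCreation.optimalCost (Fin (m + 1)) α := by gcongr
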